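/- Let $D\ge 1$. For words $w_1^k$ and $z_1^m$ over $\{1,\dots,D\}$ let $c(w_1^k|z_1^m)=\#\{0\le i\le m-k: w_1^k=z_{i+1}^{i+k}\}$, and let $\mathbf L(z_1^m)=\max\{k: \exists w_1^k:\ c(w_1^k|z_1^m)>1\}$ be the maximal length of a substring that occurs at least twice in $z_1^m$. Let $y_1^j$ ($j\ge 0$, the training data) and $x_1^n$ ($n\ge 1$) be words over $\{1,\dots,D\}$, and let $p_0,p_1,\ldots\in(0,1)$ satisfy $\prod_{i=0}^\infty p_i>0$; put $q_i=1-p_i$. Put $B(x_{l+1}|x_1^l,-1)=D^{-1}$ and, for $0\le k\le l$, $$B(x_{l+1}|x_1^l,k)=\frac{c(x_{l+1-k}^{l+1}\,|\,y_1^jx_1^l)+B(x_{l+1}|x_1^l,k-1)}{c(x_{l+1-k}^{l}\,|\,y_1^jx_1^{l-1})+1},$$ where $y_1^jx_1^{l-1}$ denotes the first $j+l-1$ letters of $y_1^jx_1^l$ (and the frequency is $0$ if $j=l=0$). The preadapted switch distribution is $$P(x_1^n)=\sum_{k=-1}^{n-1}P(x_1^n,k),$$ where $P(x_1,-1)=p_0B(x_1|-1)$,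 $P(x_1,0)=q_0B(x_1|0)$ (here $B(x_1|k)$ is $B(x_{l+1}|x_1^l,k)$ with $l=0$), $P(x_1^l,k)=0$ for $k<-1$ or $k\ge l$, and $$P(x_1^{l+1},k)=\big[p_lP(x_1^l,k)+q_lP(x_1^l,k-1)\big]B(x_{l+1}|x_1^l,k)\qquad(l\ge 1,\ -1\le k\le l).$$ Then $P(x_1^n)$ can be computed in time $O((j+n)s)$, where $s=\max\{1,\mathbf L(y_1^jx_1^n)\}$. Precisely: there are a single program for a random access machine with exact real arithmetic and absolute constants $C,e$ such that, for all $D$, $y_1^j$, $x_1^n$ and $(p_i)$ as above, the program, given $D$, $j$, $n$, $y_1^j$, $x_1^n$ and $p_0,\dots,p_{n-1}$ in otherwise zero memory, outputs $P(x_1^n)$ after at most $C(j+n)s$ steps. One step is an access to an array, a comparison of two natural numbers, an operation $+$, truncated $-$ or $\times$ on natural numbers, a setting of a constant, a conversion of a natural number to a real, or a real operation $+,-,\times,/$; all natural numbers handled by the program are at most $(j+n+D)^e$. -/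

import Mathlib

namespace SwitchDist

/-! ### The preadapted switch distribution

Words over the alphabet `{1, …, D}` are lists over `Fin D`. -/

/-- The frequency `c(w | z₁ᵐ)` of the word `w` in the prefix of length `m` of `z`
(`-1 ≤ m ≤ |z|`): the number of `i` with `0 ≤ i ≤ m - |w|` such that `w` is the subword of `z`
that starts after the first `i` letters. The value `m = -1` gives the empty sum. -/
def freq {D : ℕ} (w z : List (Fin D)) (m : ℤ) : ℕ :=
  ((Finset.range (m + 1 - w.length).toNat).filter (fun i => w <+: z.drop i)).card

/-- The subword `x_{a+1} … x_b` of `x = x₁ x₂ …`. -/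
def subword {D : ℕ} (x : List (Fin D)) (a b : ℕ) : List (Fin D) := (x.take b).drop a

/-- The depth `L(z)` of `z`: the maximal length of a word that occurs at least twice in `z`. -/
noncomputable def depth {D : ℕ} (z : List (Fin D)) : ℕ :=
  sSup {k : ℕ | ∃ w : List (Fin D), w.length = k ∧ 1 < freq w z z.length}

/-- `condProbAux y x n (k + 1)` is the conditional probability `B(x_{n+1} | x₁ⁿ, k)` with training
data `y`, for `-1 ≤ k ≤ n < |x|`. The prefixes of length `j + n` and `j + n - 1` of `y ++ x`, where
`j = |y|`, are `y₁ʲ x₁ⁿ` and `y₁ʲ x₁ⁿ⁻¹` (which is `y₁ʲ⁻¹` for `n = 0`). -/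
noncomputable def condProbAux {D : ℕ} (y x : List (Fin D)) (n : ℕ) : ℕ → ℝ
  | 0 => 1 / (D : ℝ)
  | k + 1 =>
      ((freq (subword x (n - k) (n + 1)) (y ++ x) ((y.length : ℤ) + n) : ℝ) + condProbAux y x n k) /
        ((freq (subword x (n - k) n) (y ++ x) ((y.length : ℤ) + n - 1) : ℝ) + 1)

/-- The conditional probability `B(x_{n+1} | x₁ⁿ, k)` with training data `y`,
for `-1 ≤ k ≤ n < |x|`. -/
noncomputable def condProb {D : ℕ} (y x : List (Fin D)) (n : ℕ) (k : ℤ) : ℝ :=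
  condProbAux y x n (k + 1).toNat

/-- The partial switch distribution `P(x₁ⁿ, k)` with training data `y` and coefficients `p`,
for `1 ≤ n ≤ |x|` (and the dummy value `0` for `n = 0`). -/
noncomputable def partialProb {D : ℕ} (y : List (Fin D)) (p : ℕ → ℝ) (x : List (Fin D)) :
    ℕ → ℤ → ℝ
  | 0, _ => 0
  | 1, k =>
      if k = -1 then p 0 * condProb y x 0 (-1)
      else if k = 0 then (1 - p 0) * condProb y x 0 0
      else 0
  | n + 2, k =>
      if -1 ≤ k ∧ k ≤ (n : ℤ) + 1 then
        (p (n + 1) * partialProb y p x (n + 1) k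
          + (1 - p (n + 1)) * partialProb y p x (n + 1) (k - 1)) * condProb y x (n + 1) k
      else 0

/-- The preadapted switch probability `P(x)` of a nonempty word `x`, with training data `y` and
coefficients `p`. -/
noncomputable def switchProb {D : ℕ} (y : List (Fin D)) (p : ℕ → ℝ) (x : List (Fin D)) : ℝ :=
  ∑ k ∈ Finset.Icc (-1 : ℤ) ((x.length : ℤ) - 1), partialProb y p x x.length k

/-- Admissible coefficients: `pₙ ∈ (0, 1)` for all `n`, and `∏ₙ pₙ > 0`. -/
def IsCoeff (p : ℕ → ℝ) : Prop :=
  (∀ n, 0 < p n ∧ p n < 1) ∧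
    ∃ δ : ℝ, 0 < δ ∧
      Filter.Tendsto (fun N => ∏ n ∈ Finset.range N, p n) Filter.atTop (nhds δ)

/-! ### A random access machine with exact real arithmetic

The machine has word registers and arrays of words, real registers and arrays of reals. A program
is a finite text, so it names finitely many registers and arrays. Words are natural numbers not
greater than a bound `W` that depends on the input size; only words are used as addresses and in
tests, and no information passes from reals to words. Every instruction and every test takes one
unit of time. -/

/-- Memory contents. `arr A i` and `realArr A i` are the entries with index `i` of the arrays with
name `A`. -/
structure State where
  reg : ℕ → ℕ
  arr : ℕ → ℕ → ℕ
  realReg : ℕ → ℝ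
  realArr : ℕ → ℕ → ℝ

/-- Instructions (`sub` is truncated subtraction); the arguments are names of registers and arrays, except the constant in
`const`. -/
inductive Instr where
  | const (d c : ℕ)
  | add (d a b : ℕ)
  | sub (d a b : ℕ)
  | mul (d a b : ℕ)
  | load (d A a : ℕ)
  | store (A a b : ℕ)
  | realCast (d a : ℕ)
  | realAdd (d a b : ℕ)
  | realSub (d a b : ℕ)
  | realMul (d a b : ℕ)
  | realDiv (d a b : ℕ)
  | realLoad (d A a : ℕ)
  | realStore (A a b : ℕ)

/-- Write a word to a register; fails on overflow. -/
def State.setReg (W : ℕ) (σ : State) (d v : ℕ) : Option State :=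
  if v ≤ W then some { σ with reg := Function.update σ.reg d v } else none

/-- Write a real number to a real register. -/
noncomputable def State.setReal (σ : State) (d : ℕ) (v : ℝ) : State :=
  { σ with realReg := Function.update σ.realReg d v }

open Classical in
/-- The effect of one instruction; `none` means failure (overflow or division by zero). -/
noncomputable def Instr.exec (W : ℕ) : Instr → State → Option State
  | .const d c, σ => σ.setReg W d c
  | .add d a b, σ => σ.setReg W d (σ.reg a + σ.reg b)
  | .sub d a b, σ => σ.setReg W d (σ.reg a - σ.reg b)
  | .mul d a b, σ => σ.setReg W d (σ.reg a * σ.reg b)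
  | .load d A a, σ => σ.setReg W d (σ.arr A (σ.reg a))
  | .store A a b, σ =>
      some { σ with arr := Function.update σ.arr A
                      (Function.update (σ.arr A) (σ.reg a) (σ.reg b)) }
  | .realCast d a, σ => some (σ.setReal d (σ.reg a : ℝ))
  | .realAdd d a b, σ => some (σ.setReal d (σ.realReg a + σ.realReg b))
  | .realSub d a b, σ => some (σ.setReal d (σ.realReg a - σ.realReg b))
  | .realMul d a b, σ => some (σ.setReal d (σ.realReg a * σ.realReg b))
  | .realDiv d a b, σ =>
      if σ.realReg b = 0 then none else some (σ.setReal d (σ.realReg a / σ.realReg b))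
  | .realLoad d A a, σ => some (σ.setReal d (σ.realArr A (σ.reg a)))
  | .realStore A a b, σ =>
      some { σ with realArr := Function.update σ.realArr A
                      (Function.update (σ.realArr A) (σ.reg a) (σ.realReg b)) }

/-- Tests compare two word registers. -/
inductive Test where
  | lt (a b : ℕ)
  | eq (a b : ℕ)

def Test.Holds : Test → State → Prop
  | .lt a b, σ => σ.reg a < σ.reg b
  | .eq a b, σ => σ.reg a = σ.reg b

/-- Programs. -/
inductive Prog where
  | instr (i : Instr)
  | seq (c d : Prog)
  | branch (b : Test) (c d : Prog)
  | loop (b : Test) (c : Prog)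

/-- `c.Run W σ t τ`: with word bound `W`, the program `c` started in state `σ` halts without failure
after exactly `t` units of time in state `τ`. -/
inductive Prog.Run (W : ℕ) : Prog → State → ℕ → State → Prop where
  | instr {i : Instr} {σ τ : State} (h : i.exec W σ = some τ) : Prog.Run W (.instr i) σ 1 τ
  | seq {c d : Prog} {σ τ υ : State} {t u : ℕ}
      (hc : Prog.Run W c σ t τ) (hd : Prog.Run W d τ u υ) : Prog.Run W (.seq c d) σ (t + u) υ
  | branchTrue {b : Test} {c d : Prog} {σ τ : State} {t : ℕ}
      (hb : b.Holds σ) (hc : Prog.Run W c σ t τ) : Prog.Run W (.branch b c d) σ (t + 1) τ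
  | branchFalse {b : Test} {c d : Prog} {σ τ : State} {t : ℕ}
      (hb : ¬ b.Holds σ) (hd : Prog.Run W d σ t τ) : Prog.Run W (.branch b c d) σ (t + 1) τ
  | loopFalse {b : Test} {c : Prog} {σ : State}
      (hb : ¬ b.Holds σ) : Prog.Run W (.loop b c) σ 1 σ
  | loopTrue {b : Test} {c : Prog} {σ τ υ : State} {t u : ℕ}
      (hb : b.Holds σ) (hc : Prog.Run W c σ t τ) (hl : Prog.Run W (.loop b c) τ u υ) :
      Prog.Run W (.loop b c) σ (t + u + 1) υ

/-- The array of the letters of a word, as numbers in `{1, …, D}`, filled up with zeros. -/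
def letters {D : ℕ} (w : List (Fin D)) (i : ℕ) : ℕ :=
  if h : i < w.length then (w[i] : ℕ) + 1 else 0

/-- The initial state: registers `0, 1, 2` hold `D, |y|, |x|`, arrays `0, 1` hold the letters of
`y` and `x`, real array `0` holds `p₀, …, p_{|x|-1}`, and everything else is zero. -/
noncomputable def inputState {D : ℕ} (y x : List (Fin D)) (p : ℕ → ℝ) : State where
  reg := fun r => if r = 0 then D else if r = 1 then y.length else if r = 2 then x.length else 0
  arr := fun A => if A = 0 then letters y else if A = 1 then letters x else fun _ => 0
  realReg := fun _ => 0
  realArr := fun A i => if A = 0 ∧ i < x.length then p i else 0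

end SwitchDist

namespace SwitchDist

/-! ### Repeated subwords of a sequence -/

/-! Put z = y ++ x and N = |z|. Numerator and denominator of B(x_{l+1} | x₁ˡ, k) count the
occurrences of words of length k + 1 and k that start before one and the same place j + l - k of z
(`condProbAux_succ`). Hence order k needs only the numbers `prevCount` of previous occurrences, for
lengths k and k + 1, at all places.

These numbers are obtained length by length, in O(N) steps each. A word of length k is named by its
first occurrence; the word of length k + 1 at the same place is determined by this name and the next
letter, and the pair, coded as one number `key`, addresses a table of counters. Different lengths
use disjoint ranges of keys, so no table is ever cleared. In the same round the column P(·, k) is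
computed from the column P(·, k - 1) by one sweep over l.

The rounds stop at the least k for which no word of length k occurs twice; this k is at most L(z) +
1 (`exists_unrepeated`). From there on all frequencies vanish and B no longer depends on the order
(`condProbAux_eq_of_unrepeated`). The recursions of all remaining orders then share one factor, so
their sum satisfies a scalar recursion (`tailWeight_succ`) and costs O(n). The total is O(N (L(z) +
2)) steps. Correctness is carried by the loop invariants `ExtendInv`, `MixInv`, `LevelInv` and
`TailInv`. -/

/-- The length-`k` subwords of `f` at positions `a` and `b` coincide. -/
def Same (f : ℕ → ℕ) (k a b : ℕ) : Prop := ∀ m < k, f (a + m) = f (b + m)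

instance (f : ℕ → ℕ) (k a b : ℕ) : Decidable (Same f k a b) :=
  inferInstanceAs (Decidable (∀ m < k, f (a + m) = f (b + m)))

theorem Same.refl (f : ℕ → ℕ) (k a : ℕ) : Same f k a a := fun _ _ => rfl

theorem Same.symm {f : ℕ → ℕ} {k a b : ℕ} (h : Same f k a b) : Same f k b a :=
  fun m hm => (h m hm).symm

theorem Same.trans {f : ℕ → ℕ} {k a b c : ℕ} (h : Same f k a b) (h' : Same f k b c) :
    Same f k a c := fun m hm => (h m hm).trans (h' m hm)

theorem Same.mono {f : ℕ → ℕ} {k k' a b : ℕ} (hk : k ≤ k') (h : Same f k' a b) : Same f k a b :=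
  fun m hm => h m (hm.trans_le hk)

theorem same_succ {f : ℕ → ℕ} {k a b : ℕ} :
    Same f (k + 1) a b ↔ Same f k a b ∧ f (a + k) = f (b + k) :=
  ⟨fun h => ⟨h.mono k.le_succ, h k k.lt_succ_self⟩, fun h m hm => by
    rcases Nat.lt_succ_iff_lt_or_eq.1 hm with h1 | rfl
    exacts [h.1 m h1, h.2]⟩

/-- The number of occurrences of the length-`k` subword at `a` that start before `a`. -/
def prevCount (f : ℕ → ℕ) (k a : ℕ) : ℕ := ((Finset.range a).filter (fun i => Same f k i a)).card

theorem prevCount_zero (f : ℕ → ℕ) (a : ℕ) : prevCount f 0 a = a := by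
  simp [prevCount, Same]

theorem prevCount_le (f : ℕ → ℕ) (k a : ℕ) : prevCount f k a ≤ a :=
  (Finset.card_filter_le _ _).trans (by simp)

theorem prevCount_eq_zero {f : ℕ → ℕ} {k a : ℕ} :
    prevCount f k a = 0 ↔ ∀ i < a, ¬ Same f k i a := by
  simp [prevCount, Finset.filter_eq_empty_iff]

/-- The first occurrence of the length-`k` subword at `a`. -/
noncomputable def firstOcc (f : ℕ → ℕ) (k a : ℕ) : ℕ := sInf {i | Same f k i a}

theorem firstOcc_same (f : ℕ → ℕ) (k a : ℕ) : Same f k (firstOcc f k a) a :=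
  Nat.sInf_mem (s := {i | Same f k i a}) ⟨a, Same.refl f k a⟩

theorem firstOcc_le (f : ℕ → ℕ) (k a : ℕ) : firstOcc f k a ≤ a :=
  Nat.sInf_le (s := {i | Same f k i a}) (Same.refl f k a)

theorem firstOcc_eq_iff {f : ℕ → ℕ} {k a b : ℕ} :
    firstOcc f k a = firstOcc f k b ↔ Same f k a b := by
  refine ⟨fun h => (firstOcc_same f k a).symm.trans (h ▸ firstOcc_same f k b), fun h => ?_⟩
  have : {i | Same f k i a} = {i | Same f k i b} :=
    Set.ext fun i => ⟨fun hi => hi.trans h, fun hi => hi.trans h.symm⟩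
  simp [firstOcc, this]

theorem firstOcc_zero (f : ℕ → ℕ) (a : ℕ) : firstOcc f 0 a = 0 :=
  Nat.le_zero.1 (Nat.sInf_le (s := {i | Same f 0 i a}) (by simp [Same]))

theorem firstOcc_eq_self {f : ℕ → ℕ} {k a : ℕ} (h : prevCount f k a = 0) : firstOcc f k a = a := by
  by_contra hne
  exact prevCount_eq_zero.1 h _ (lt_of_le_of_ne (firstOcc_le f k a) hne) (firstOcc_same f k a)

/-- A numerical name of the subword of length `k + 1` at `a`. -/
noncomputable def key (f : ℕ → ℕ) (D M k a : ℕ) : ℕ :=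
  (k * M + firstOcc f k a) * (D + 1) + f (a + k)

/-- The last letter is at most D, so it is the remainder of the key modulo D + 1, and the quotient
gives back the first occurrence. -/
theorem key_eq_iff {f : ℕ → ℕ} {D M k a b : ℕ} (hf : ∀ i, f i ≤ D) :
    key f D M k a = key f D M k b ↔ Same f (k + 1) a b := by
  rw [same_succ, ← firstOcc_eq_iff]
  refine ⟨fun h => ?_, fun h => by rw [key, key, h.1, h.2]⟩
  have ha := Nat.lt_succ_of_le (hf (a + k))
  have hb := Nat.lt_succ_of_le (hf (b + k))
  have h1 := congrArg (· / (D + 1)) h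
  have h2 := congrArg (· % (D + 1)) h
  simp only [key] at h1 h2
  rw [Nat.add_div_of_dvd_right (Dvd.intro_left _ rfl), Nat.add_div_of_dvd_right
    (Dvd.intro_left _ rfl), Nat.div_eq_of_lt ha, Nat.div_eq_of_lt hb] at h1
  rw [Nat.mul_add_mod_self_right, Nat.mul_add_mod_self_right, Nat.mod_eq_of_lt ha,
    Nat.mod_eq_of_lt hb] at h2
  simp at h1
  exact ⟨h1, h2⟩

theorem key_ge (f : ℕ → ℕ) (D M k a : ℕ) : k * M * (D + 1) ≤ key f D M k a :=
  (Nat.mul_le_mul_right _ (Nat.le_add_right _ _)).trans (Nat.le_add_right _ _)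

/-- With `key_ge` this puts the keys of different k into disjoint intervals. -/
theorem key_lt {f : ℕ → ℕ} {D M k a : ℕ} (hf : ∀ i, f i ≤ D) (ha : a < M) :
    key f D M k a < (k + 1) * M * (D + 1) := by
  have h1 : k * M + firstOcc f k a + 1 ≤ (k + 1) * M := by
    have := firstOcc_le f k a
    rw [add_one_mul]; omega
  have h2 := Nat.mul_le_mul_right (D + 1) h1
  have h3 := hf (a + k)
  unfold key
  rw [add_one_mul] at h2
  omega

/-! ### Frequencies and depth -/

theorem letters_le {D : ℕ} (z : List (Fin D)) (i : ℕ) : letters z i ≤ D := by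
  unfold letters
  split
  · omega
  · omega

theorem letters_append {D : ℕ} (y x : List (Fin D)) (i : ℕ) :
    letters (y ++ x) i = if i < y.length then letters y i else letters x (i - y.length) := by
  unfold letters
  by_cases h : i < y.length
  · simp [h, List.getElem_append_left, Nat.lt_add_right]
  · have : i < y.length + x.length ↔ i - y.length < x.length := by omega
    simp [h, this, List.getElem_append_right (not_lt.1 h)]

theorem prefix_drop_iff_same {D : ℕ} {z : List (Fin D)} {k a i : ℕ} (h : a + k ≤ z.length) :
    (z.drop a).take k <+: z.drop i ↔ Same (letters z) k i a := by
  rw [List.prefix_iff_getElem]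
  have hl : ((z.drop a).take k).length = k := by simp; omega
  constructor
  · rintro ⟨h1, h2⟩ m hm
    rw [hl, List.length_drop] at h1
    have := h2 m (hl.symm ▸ hm)
    simp only [List.getElem_take, List.getElem_drop] at this
    simp [letters, show a + m < z.length by omega, show i + m < z.length by omega, this]
  · intro h1
    -- Letters of z are coded by positive numbers and places beyond the end by 0, so a match cannot
    -- run over the end of z.
    have hi : k ≤ z.length - i := by
      rcases Nat.eq_zero_or_pos k with rfl | hk
      · simp
      have := h1 (k - 1) (by omega)
      by_contra hc
      simp [letters, show a + (k - 1) < z.length by omega,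
        show ¬ i + (k - 1) < z.length by omega] at this
    refine ⟨by rw [hl, List.length_drop]; exact hi, fun m hm => ?_⟩
    rw [hl] at hm
    have := h1 m hm
    simp [letters, show a + m < z.length by omega, show i + m < z.length by omega] at this
    simp only [List.getElem_take, List.getElem_drop]
    exact (Fin.ext this).symm

/-- The prefix of length m = a + k - 1 lacks just the last letter of the occurrence at a, so the
occurrences inside it are those that start before a. For k = 0 the prefix has length a - 1, which is
why m may be -1. -/
theorem freq_eq_prevCount {D : ℕ} {z : List (Fin D)} {k a : ℕ} {m : ℤ} (h : a + k ≤ z.length)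
    (hm : m + 1 = a + k) : freq ((z.drop a).take k) z m = prevCount (letters z) k a := by
  have hl : ((z.drop a).take k).length = k := by simp; omega
  have hr : (m + 1 - ((z.drop a).take k).length).toNat = a := by rw [hl]; omega
  unfold freq prevCount
  rw [hr]
  congr 1
  ext i
  simp [prefix_drop_iff_same h]

theorem subword_eq {D : ℕ} (y x : List (Fin D)) (a b : ℕ) :
    subword x a b = ((y ++ x).drop (y.length + a)).take (b - a) := by
  simp [subword, List.drop_append, List.drop_take, List.drop_eq_nil_of_le]

theorem le_depth {D : ℕ} {z : List (Fin D)} {k a : ℕ} (h : a + k ≤ z.length)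
    (hp : prevCount (letters z) k a ≠ 0) : k ≤ depth z := by
  refine le_csSup ⟨z.length, ?_⟩ ⟨(z.drop a).take k, by simp; omega, ?_⟩
  · rintro m ⟨w, rfl, hw⟩
    by_contra hc
    have := Finset.card_filter_le (Finset.range ((z.length : ℤ) + 1 - w.length).toNat)
      (fun i => w <+: z.drop i)
    rw [Finset.card_range] at this
    unfold freq at hw
    omega
  · have hl : ((z.drop a).take k).length = k := by simp; omega
    obtain ⟨i, hi, hs⟩ : ∃ i < a, Same (letters z) k i a := by
      by_contra hc
      push Not at hc
      exact hp (prevCount_eq_zero.2 hc)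
    unfold freq
    refine Finset.one_lt_card.2 ⟨i, ?_, a, ?_, hi.ne⟩
    · rw [Finset.mem_filter, Finset.mem_range, hl]
      exact ⟨by omega, (prefix_drop_iff_same h).2 hs⟩
    · rw [Finset.mem_filter, Finset.mem_range, hl]
      exact ⟨by omega, (prefix_drop_iff_same h).2 (Same.refl _ _ _)⟩

theorem condProbAux_succ {D : ℕ} {y x : List (Fin D)} {l k : ℕ} (hk : k ≤ l) (hl : l < x.length) :
    condProbAux y x l (k + 1) =
      ((prevCount (letters (y ++ x)) (k + 1) (y.length + (l - k)) : ℝ) + condProbAux y x l k) /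
        ((prevCount (letters (y ++ x)) k (y.length + (l - k)) : ℝ) + 1) := by
  rw [condProbAux, subword_eq y, subword_eq y, show l + 1 - (l - k) = k + 1 by omega,
    show l - (l - k) = k by omega, freq_eq_prevCount, freq_eq_prevCount] <;> simp <;> omega

theorem prevCount_eq_zero_of_le {N k k' : ℕ} {f : ℕ → ℕ}
    (h : ∀ i, i + k ≤ N → prevCount f k i = 0) (hk : k ≤ k') {i : ℕ} (hi : i + k' ≤ N) :
    prevCount f k' i = 0 :=
  prevCount_eq_zero.2 fun a ha hs =>
    prevCount_eq_zero.1 (h i (by omega)) a ha (hs.mono hk)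

/-! ### Switch weights -/

/-- `weight y p x l m` is `P(x₁ˡ, m - 1)`, where all the mass sits at `m = 0` for `l = 0`. -/
noncomputable def weight {D : ℕ} (y : List (Fin D)) (p : ℕ → ℝ) (x : List (Fin D)) :
    ℕ → ℕ → ℝ
  | 0, m => if m = 0 then 1 else 0
  | l + 1, m => partialProb y p x (l + 1) ((m : ℤ) - 1)

section
variable {D : ℕ} {y x : List (Fin D)} {p : ℕ → ℝ}

theorem weight_eq_zero {l m : ℕ} (h : l < m) : weight y p x l m = 0 := by
  match l with
  | 0 => simp [weight]; omega
  | 1 =>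
    rw [weight, partialProb, if_neg (by omega), if_neg (by omega)]
  | l + 2 => rw [weight, partialProb, if_neg (by omega)]

theorem partialProb_neg_two {l : ℕ} : partialProb y p x l (-2) = 0 := by
  match l with
  | 0 => simp [partialProb]
  | 1 => simp [partialProb]
  | l + 2 => simp [partialProb]

/-- Starting from unit mass at m = 0 turns the initial values P(x₁, -1) and P(x₁, 0) into instances
of the general recursion, here and in `weight_succ_succ`. -/
theorem weight_succ_zero (l : ℕ) :
    weight y p x (l + 1) 0 = weight y p x l 0 * p l * (1 / D) := by
  match l with
  | 0 => simp [weight, partialProb, condProb, condProbAux]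
  | l + 1 =>
    rw [weight, partialProb, if_pos (by omega), weight]
    have : ((0 : ℕ) : ℤ) - 1 - 1 = -2 := by norm_num
    rw [this, partialProb_neg_two]
    simp [condProb, condProbAux]
    ring_nf
    tauto

theorem weight_succ_succ (l m : ℕ) :
    weight y p x (l + 1) (m + 1) =
      (weight y p x l (m + 1) * p l + weight y p x l m * (1 - p l)) *
        condProbAux y x l (m + 1) := by
  by_cases h : l < m
  · rw [weight_eq_zero (by omega), weight_eq_zero (by omega), weight_eq_zero h]; simp
  match l with
  | 0 =>
    obtain rfl : m = 0 := by omega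
    simp [weight, partialProb, condProb]
  | l + 1 =>
    rw [weight, partialProb, if_pos (by push_cast; omega), weight, weight, condProb]
    have h1 : (((m + 1 : ℕ) : ℤ) - 1 + 1).toNat = m + 1 := by omega
    have h2 : ((m + 1 : ℕ) : ℤ) - 1 - 1 = (m : ℤ) - 1 := by push_cast; ring
    rw [h1, h2]
    ring

theorem switchProb_eq (hx : x ≠ []) :
    switchProb y p x = ∑ m ∈ Finset.range (x.length + 1), weight y p x x.length m := by
  obtain ⟨n, hn⟩ : ∃ n, x.length = n + 1 :=
    Nat.exists_eq_succ_of_ne_zero (by simpa using hx)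
  unfold switchProb
  rw [hn]
  symm
  refine Finset.sum_bij (fun m _ => (m : ℤ) - 1) ?_ ?_ ?_ ?_
  · intro m hm; simp at hm ⊢; omega
  · intro a _ b _ h; simpa using h
  · intro b hb
    simp at hb
    exact ⟨(b + 1).toNat, by simp; omega, by omega⟩
  · intro m _; rfl

/-- The total weight of the orders beyond `m`. -/
noncomputable def tailWeight {D : ℕ} (y : List (Fin D)) (p : ℕ → ℝ) (x : List (Fin D))
    (m l : ℕ) : ℝ :=
  ∑ i ∈ Finset.range x.length, weight y p x l (m + 1 + i)

theorem tailWeight_eq_zero {m l : ℕ} (h : l ≤ m) : tailWeight y p x m l = 0 :=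
  Finset.sum_eq_zero fun _ _ => weight_eq_zero (by omega)

/-- With both frequencies zero, the recursion for B reads (0 + B) / (0 + 1) = B. -/
theorem condProbAux_eq_of_unrepeated {k l m : ℕ}
    (h : ∀ i, i + k ≤ (y ++ x).length → prevCount (letters (y ++ x)) k i = 0)
    (hl : l < x.length) (hk : k ≤ m) (hm : m ≤ l + 1) :
    condProbAux y x l m = condProbAux y x l k := by
  induction m, hk using Nat.le_induction with
  | base => rfl
  | succ m hk ih =>
    have hz : y.length + l < (y ++ x).length := by simp; omega
    rw [condProbAux_succ (by omega) hl, prevCount_eq_zero_of_le h (by omega) (by omega),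
      prevCount_eq_zero_of_le h hk (by omega), ih (by omega)]
    simp

/-- All orders in the tail share the same factor B, so it can be pulled out of the sum. The mass
entering by a switch is the tail shifted by one, which adds only the term with index k. -/
theorem tailWeight_succ {k l : ℕ} (hk : 0 < k)
    (h : ∀ i, i + k ≤ (y ++ x).length → prevCount (letters (y ++ x)) k i = 0)
    (hl : l < x.length) :
    tailWeight y p x k (l + 1) =
      (tailWeight y p x k l + weight y p x l k * (1 - p l)) * condProbAux y x l k := by
  have hs : ∑ i ∈ Finset.range x.length, weight y p x l (k + i)
      = tailWeight y p x k l + weight y p x l k := by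
    have h1 := Finset.sum_range_succ (fun i => weight y p x l (k + i)) x.length
    have h2 := Finset.sum_range_succ' (fun i => weight y p x l (k + i)) x.length
    -- The shifted sum loses nothing at its upper end, since l < |x| ≤ k + |x|.
    rw [weight_eq_zero (show l < k + x.length by omega), add_zero] at h1
    rw [← h1, h2, tailWeight, add_zero]
    congr 1
    exact Finset.sum_congr rfl fun i _ => by congr 1; ring
  have ht : tailWeight y p x k (l + 1) = ∑ i ∈ Finset.range x.length,
      (weight y p x l (k + 1 + i) * p l + weight y p x l (k + i) * (1 - p l)) *
        condProbAux y x l k := by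
    refine Finset.sum_congr rfl fun i _ => ?_
    rw [show k + 1 + i = k + i + 1 by ring, weight_succ_succ]
    by_cases hi : l < k + i
    · rw [weight_eq_zero hi, weight_eq_zero (show l < k + i + 1 by omega)]; simp
    · rw [condProbAux_eq_of_unrepeated h hl (show k ≤ k + i + 1 by omega) (by omega)]
  rw [ht, ← Finset.sum_mul, Finset.sum_add_distrib, ← Finset.sum_mul, ← Finset.sum_mul, hs,
    ← tailWeight]
  ring

theorem switchProb_eq_tail (hx : x ≠ []) (k : ℕ) :
    switchProb y p x = ∑ m ∈ Finset.range (k + 1), weight y p x x.length m +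
      tailWeight y p x k x.length := by
  rw [switchProb_eq hx, tailWeight, ← Finset.sum_range_add]
  refine Finset.sum_subset (fun i => by simp; omega) fun i _ hi => weight_eq_zero ?_
  simp at hi; omega

end

/-! ### Weakest preconditions -/

/-- `c.WP W T Q σ`: started in `σ`, the program `c` halts within `T` steps in a state with `Q`. -/
def Prog.WP (W : ℕ) (c : Prog) (T : ℕ) (Q : State → Prop) (σ : State) : Prop :=
  ∃ t τ, t ≤ T ∧ c.Run W σ t τ ∧ Q τ

/-- A condition under which an instruction does not fail. -/
def Instr.Pre (W : ℕ) : Instr → State → Prop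
  | .const _ c, _ => c ≤ W
  | .add _ a b, σ => σ.reg a + σ.reg b ≤ W
  | .sub _ a b, σ => σ.reg a - σ.reg b ≤ W
  | .mul _ a b, σ => σ.reg a * σ.reg b ≤ W
  | .load _ A a, σ => σ.arr A (σ.reg a) ≤ W
  | .realDiv _ _ b, σ => σ.realReg b ≠ 0
  | _, _ => True

/-- The effect of an instruction that does not fail. -/
noncomputable def Instr.eff : Instr → State → State
  | .const d c, σ => { σ with reg := Function.update σ.reg d c }
  | .add d a b, σ => { σ with reg := Function.update σ.reg d (σ.reg a + σ.reg b) }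
  | .sub d a b, σ => { σ with reg := Function.update σ.reg d (σ.reg a - σ.reg b) }
  | .mul d a b, σ => { σ with reg := Function.update σ.reg d (σ.reg a * σ.reg b) }
  | .load d A a, σ => { σ with reg := Function.update σ.reg d (σ.arr A (σ.reg a)) }
  | .store A a b, σ =>
      { σ with arr := Function.update σ.arr A
                (Function.update (σ.arr A) (σ.reg a) (σ.reg b)) }
  | .realCast d a, σ => σ.setReal d (σ.reg a : ℝ)
  | .realAdd d a b, σ => σ.setReal d (σ.realReg a + σ.realReg b)
  | .realSub d a b, σ => σ.setReal d (σ.realReg a - σ.realReg b)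
  | .realMul d a b, σ => σ.setReal d (σ.realReg a * σ.realReg b)
  | .realDiv d a b, σ => σ.setReal d (σ.realReg a / σ.realReg b)
  | .realLoad d A a, σ => σ.setReal d (σ.realArr A (σ.reg a))
  | .realStore A a b, σ =>
      { σ with realArr := Function.update σ.realArr A
                (Function.update (σ.realArr A) (σ.reg a) (σ.realReg b)) }

theorem Instr.exec_eq {W : ℕ} {i : Instr} {σ : State} (h : i.Pre W σ) :
    i.exec W σ = some (i.eff σ) := by
  cases i <;> simp_all [Instr.Pre, Instr.exec, Instr.eff, State.setReg]

/-- Consecutive instructions. -/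
def block : Instr → List Instr → Prog
  | i, [] => .instr i
  | i, i' :: is => .seq (.instr i) (block i' is)

/-- The weakest precondition of consecutive instructions. -/
def blockWP (W : ℕ) : List Instr → (State → Prop) → State → Prop
  | [], Q, σ => Q σ
  | i :: is, Q, σ => i.Pre W σ ∧ blockWP W is Q (i.eff σ)

section
variable {W T U : ℕ} {Q R : State → Prop} {σ : State} {c d : Prog}

theorem Prog.WP.block {i : Instr} {is : List Instr} (h : blockWP W (i :: is) Q σ)
    (hT : is.length + 1 ≤ T) : (block i is).WP W T Q σ := by
  induction is generalizing i σ T with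
  | nil => exact ⟨1, _, by simpa using hT, .instr (Instr.exec_eq h.1), h.2⟩
  | cons i' is ih =>
    obtain ⟨t, τ, ht, hr, hq⟩ := ih h.2 le_rfl
    exact ⟨1 + t, τ, by simp at hT; omega, .seq (.instr (Instr.exec_eq h.1)) hr, hq⟩

theorem Prog.WP.mono (h : c.WP W T Q σ) (hT : T ≤ U) (hQ : ∀ τ, Q τ → R τ) : c.WP W U R σ := by
  obtain ⟨t, τ, ht, hr, hq⟩ := h
  exact ⟨t, τ, ht.trans hT, hr, hQ τ hq⟩

theorem Prog.WP.seq (h : c.WP W T (fun τ => d.WP W U Q τ) σ) :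
    (Prog.seq c d).WP W (T + U) Q σ := by
  obtain ⟨t, τ, ht, hr, u, υ, hu, hr', hq⟩ := h
  exact ⟨t + u, υ, by omega, .seq hr hr', hq⟩

theorem Prog.WP.seq' {V : ℕ} (h : c.WP W T R σ) (h' : ∀ τ, R τ → d.WP W U Q τ)
    (hV : T + U ≤ V) : (Prog.seq c d).WP W V Q σ :=
  (Prog.WP.seq (h.mono le_rfl h')).mono hV fun _ => id

theorem Prog.WP.branch {b : Test} (h : b.Holds σ → c.WP W T Q σ)
    (h' : ¬ b.Holds σ → d.WP W T Q σ) : (Prog.branch b c d).WP W (T + 1) Q σ := by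
  by_cases hb : b.Holds σ
  · obtain ⟨t, τ, ht, hr, hq⟩ := h hb
    exact ⟨t + 1, τ, by omega, .branchTrue hb hr, hq⟩
  · obtain ⟨t, τ, ht, hr, hq⟩ := h' hb
    exact ⟨t + 1, τ, by omega, .branchFalse hb hr, hq⟩

theorem Prog.WP.loop {b : Test} (I : ℕ → State → Prop) {m : ℕ}
    (hbody : ∀ i < m, ∀ σ, I i σ → b.Holds σ ∧ c.WP W T (I (i + 1)) σ)
    (hend : ∀ σ, I m σ → ¬ b.Holds σ) (h0 : I 0 σ) :
    (Prog.loop b c).WP W (m * (T + 1) + 1) (I m) σ := by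
  -- The induction is on the number of rounds that remain.
  suffices H : ∀ i ≤ m, ∀ σ, I (m - i) σ →
      (Prog.loop b c).WP W (i * (T + 1) + 1) (I m) σ from H m le_rfl σ (by simpa using h0)
  intro i
  induction i with
  | zero => exact fun _ σ h => ⟨1, σ, by omega, .loopFalse (hend σ h), h⟩
  | succ i ih =>
    intro hi σ h
    obtain ⟨hb, t, τ, ht, hr, hq⟩ := hbody _ (by omega) σ h
    rw [show m - (i + 1) + 1 = m - i by omega] at hq
    obtain ⟨u, υ, hu, hr', hq'⟩ := ih (by omega) τ hq
    exact ⟨t + u + 1, υ, by rw [add_one_mul]; omega, .loopTrue hb hr hr', hq'⟩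

end

/-! ### The program -/

/-- Registers: `0, 1, 2` are `D, |y|, |x|`; `3` is `N = |y| + |x|`; `4` is `1`; `5, 6` are
`D + 1, N + 1`; `7` is the order `k`; `8, 13` are `k (N + 1), (k + 1) (N + 1)`; `9` tells whether
a word of length `k` occurs twice. Arrays: `0` is `y ++ x`; `2` names the words of length `k`; `3, 4`
count previous occurrences; `5, 6` are indexed by words of length `k + 1`. Real arrays `1, 2`
hold the conditional and partial probabilities of the current order. -/
def initConsts : Prog :=
  block (.add 3 1 2) [.const 4 1, .add 5 0 4, .add 6 3 4, .realCast 5 4, .realCast 6 0,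
    .realDiv 7 5 6, .realCast 1 4]

def initBody : Prog :=
  block (.load 12 1 10) [.add 11 1 10, .store 0 11 12, .realStore 1 10 7, .realStore 2 10 1,
    .realLoad 2 0 10, .realMul 1 1 2, .realMul 1 1 7, .add 10 10 4]

def initMid : Prog := block (.realAdd 0 0 1) [.const 10 0]

def countBody : Prog := block (.store 3 10 10) [.add 10 10 4]

def initEnd : Prog := block (.const 9 1) []

def extendStart : Prog := block (.const 9 0) [.const 10 0, .add 11 7 10, .add 13 8 6]

/-- Places are visited in increasing order, so the counter found at a key is the number of previous
occurrences. Zero means a new word, which gets its name here; otherwise the flag for a further round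
is raised. Array 4 keeps the counts for length k, needed as denominators. -/
def extendBody : Prog :=
  .seq (block (.load 12 2 10) [.mul 12 12 5, .load 15 0 11, .add 12 12 15, .load 15 3 10,
      .store 4 10 15, .load 15 5 12, .store 3 10 15, .add 16 15 4, .store 5 12 16])
    (.seq (.branch (.lt 15 4) (block (.add 16 13 10) [.store 6 12 16]) (block (.const 9 1) []))
      (block (.load 16 6 12) [.store 2 10 16, .add 10 10 4, .add 11 11 4]))

/-- Both sweeps start at l = k, where the weight of index k + 1 and the tail beyond k vanish; hence
the initial real value 0. -/
def mixStart : Prog := block (.const 12 0) [.add 10 7 12, .add 11 1 12, .realSub 1 5 5]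

/-- The recursion at l uses the old column only at l, and the new column at l is held in real
register 1; so the arrays can be overwritten in place. -/
def mixBody : Prog :=
  block (.load 12 3 11) [.load 15 4 11, .add 15 15 4, .realCast 2 12, .realCast 3 15,
    .realLoad 4 1 10, .realAdd 2 2 4, .realDiv 2 2 3, .realStore 1 10 2, .realLoad 3 2 10,
    .realStore 2 10 1, .realLoad 4 0 10, .realSub 6 5 4, .realMul 1 1 4, .realMul 3 3 6,
    .realAdd 1 1 3, .realMul 1 1 2, .add 10 10 4, .add 11 11 4]

def mixEnd : Prog := block (.realAdd 0 0 1) [.const 12 0, .add 8 13 12, .add 7 7 4]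

def levelBody : Prog :=
  .seq (.seq extendStart (.loop (.lt 11 3) extendBody))
    (.seq (.seq mixStart (.loop (.lt 10 2) mixBody)) mixEnd)

def tailBody : Prog :=
  block (.realLoad 2 1 10) [.realLoad 3 2 10, .realLoad 4 0 10, .realSub 6 5 4, .realMul 3 3 6,
    .realAdd 1 1 3, .realMul 1 1 2, .add 10 10 4]

def switchProg : Prog :=
  .seq initConsts <| .seq (.loop (.lt 10 2) initBody) <|
    .seq (.seq initMid (.seq (.loop (.lt 10 6) countBody) initEnd)) <|
    .seq (.loop (.eq 9 4) levelBody) <|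
    .seq (.seq mixStart (.loop (.lt 10 2) tailBody)) (block (.realAdd 0 0 1) [])

/-! ### Correctness and running time of the program -/

section
variable {D : ℕ} {y x : List (Fin D)} {p : ℕ → ℝ} {W : ℕ}

/-- The memory contents that stay fixed after the initialization. -/
structure Fixed {D : ℕ} (y x : List (Fin D)) (p : ℕ → ℝ) (σ : State) : Prop where
  r0 : σ.reg 0 = D
  r1 : σ.reg 1 = y.length
  r2 : σ.reg 2 = x.length
  r3 : σ.reg 3 = y.length + x.length
  r4 : σ.reg 4 = 1
  r5 : σ.reg 5 = D + 1
  r6 : σ.reg 6 = y.length + x.length + 1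
  a0 : σ.arr 0 = letters (y ++ x)
  rr5 : σ.realReg 5 = 1
  ra0 : ∀ i < x.length, σ.realArr 0 i = p i

/-- The extension of words of length `k` at the first `i` positions. -/
structure ExtendInv (y x : List (Fin D)) (p : ℕ → ℝ) (ρ : State) (k i : ℕ) (σ : State) :
    Prop extends Fixed y x p σ where
  r7 : σ.reg 7 = k
  r13 : σ.reg 13 = (k + 1) * (y.length + x.length + 1)
  r10 : σ.reg 10 = i
  r11 : σ.reg 11 = i + k
  flag : (σ.reg 9 = 0 ∧ ∀ i' < i, prevCount (letters (y ++ x)) (k + 1) i' = 0) ∨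
    (σ.reg 9 = 1 ∧ ∃ i' < i, prevCount (letters (y ++ x)) (k + 1) i' ≠ 0)
  newName : ∀ i' < i, σ.arr 2 i' =
    (k + 1) * (y.length + x.length + 1) + firstOcc (letters (y ++ x)) (k + 1) i'
  oldName : ∀ i', i ≤ i' → i' + k ≤ y.length + x.length → σ.arr 2 i' =
    k * (y.length + x.length + 1) + firstOcc (letters (y ++ x)) k i'
  newPrev : ∀ i' < i, σ.arr 3 i' = prevCount (letters (y ++ x)) (k + 1) i'
  oldPrev : ∀ i', i ≤ i' → i' + k ≤ y.length + x.length → σ.arr 3 i' =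
    prevCount (letters (y ++ x)) k i'
  savedPrev : ∀ i' < i, σ.arr 4 i' = prevCount (letters (y ++ x)) k i'
  count : ∀ a, k * (y.length + x.length + 1) * (D + 1) ≤ a → σ.arr 5 a =
    ((Finset.range i).filter
      (fun i' => key (letters (y ++ x)) D (y.length + x.length + 1) k i' = a)).card
  name : ∀ i' < i, σ.arr 6 (key (letters (y ++ x)) D (y.length + x.length + 1) k i') =
    (k + 1) * (y.length + x.length + 1) + firstOcc (letters (y ++ x)) (k + 1) i'
  realReg : σ.realReg = ρ.realReg
  realArr : σ.realArr = ρ.realArr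

theorem prevCount_eq_card_key {f : ℕ → ℕ} {D M k a : ℕ} (hf : ∀ i, f i ≤ D) :
    prevCount f (k + 1) a =
      ((Finset.range a).filter (fun i => key f D M k i = key f D M k a)).card := by
  simp only [prevCount, key_eq_iff hf]

theorem le_bound {N D W k v : ℕ} (hW : (N + 1) * (N + 1) * (D + 1) ≤ W) (hk : k < N)
    (hv : v < (k + 1) * (N + 1) * (D + 1)) : v + N + 1 ≤ W := by
  have h1 : (k + 1) * (N + 1) * (D + 1) ≤ N * (N + 1) * (D + 1) := by gcongr; omega
  nlinarith

/-- Both branches of `extendBody` have the same net effect on the arrays, so preservation of the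
invariant is proved once, apart from the machine. -/
theorem ExtendInv.step {ρ σ τ : State} {k i : ℕ} (h : ExtendInv y x p ρ k i σ)
    (hi : i + k < y.length + x.length)
    (hreg : ∀ r, r < 9 ∨ r = 13 → τ.reg r = σ.reg r)
    (h10 : τ.reg 10 = i + 1) (h11 : τ.reg 11 = i + 1 + k)
    (h9 : τ.reg 9 = if prevCount (letters (y ++ x)) (k + 1) i = 0 then σ.reg 9 else 1)
    (h0 : τ.arr 0 = σ.arr 0)
    (h2 : τ.arr 2 = Function.update (σ.arr 2) i
      ((k + 1) * (y.length + x.length + 1) + firstOcc (letters (y ++ x)) (k + 1) i))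
    (h3 : τ.arr 3 = Function.update (σ.arr 3) i (prevCount (letters (y ++ x)) (k + 1) i))
    (h4 : τ.arr 4 = Function.update (σ.arr 4) i (prevCount (letters (y ++ x)) k i))
    (h5 : τ.arr 5 = Function.update (σ.arr 5)
      (key (letters (y ++ x)) D (y.length + x.length + 1) k i)
      (prevCount (letters (y ++ x)) (k + 1) i + 1))
    (h6 : τ.arr 6 = Function.update (σ.arr 6)
      (key (letters (y ++ x)) D (y.length + x.length + 1) k i)
      ((k + 1) * (y.length + x.length + 1) + firstOcc (letters (y ++ x)) (k + 1) i))
    (hrr : τ.realReg = σ.realReg) (hra : τ.realArr = σ.realArr) :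
    ExtendInv y x p ρ k (i + 1) τ := by
  have hf : ∀ i, letters (y ++ x) i ≤ D := letters_le _
  have hlast : ∀ {P : ℕ → Prop}, (∀ i' < i, P i') → P i → ∀ i' < i + 1, P i' := by
    intro P h1 h2 i' hi'
    rcases Nat.lt_succ_iff_lt_or_eq.1 hi' with h | rfl
    exacts [h1 i' h, h2]
  constructor
  · exact ⟨by rw [hreg _ (by simp), h.r0], by rw [hreg _ (by simp), h.r1],
      by rw [hreg _ (by simp), h.r2], by rw [hreg _ (by simp), h.r3],
      by rw [hreg _ (by simp), h.r4], by rw [hreg _ (by simp), h.r5],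
      by rw [hreg _ (by simp), h.r6], by rw [h0, h.a0], by rw [hrr, h.rr5],
      by rw [hra]; exact h.ra0⟩
  · rw [hreg _ (by simp), h.r7]
  · rw [hreg _ (by simp), h.r13]
  · exact h10
  · exact h11
  · rw [h9]
    split_ifs with hp
    · rcases h.flag with ⟨h1, h2⟩ | ⟨h1, i', hi', h2⟩
      · exact .inl ⟨h1, hlast h2 hp⟩
      · exact .inr ⟨h1, i', by omega, h2⟩
    · exact .inr ⟨rfl, i, by omega, hp⟩
  · rw [h2]
    refine hlast (fun i' hi' => ?_) (by simp)
    rw [Function.update_of_ne hi'.ne, h.newName i' hi']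
  · intro i' h1 h1'
    rw [h2, Function.update_of_ne (by omega), h.oldName i' (by omega) h1']
  · rw [h3]
    refine hlast (fun i' hi' => ?_) (by simp)
    rw [Function.update_of_ne hi'.ne, h.newPrev i' hi']
  · intro i' h1 h1'
    rw [h3, Function.update_of_ne (by omega), h.oldPrev i' (by omega) h1']
  · rw [h4]
    refine hlast (fun i' hi' => ?_) (by simp)
    rw [Function.update_of_ne hi'.ne, h.savedPrev i' hi']
  · intro a ha
    rw [h5, Finset.range_add_one, Finset.filter_insert, Function.update_apply]
    split_ifs with h1 h2 h2
    · rw [h1, Finset.card_insert_of_notMem (by simp), ← prevCount_eq_card_key hf]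
    · exact absurd h1.symm h2
    · exact absurd h2.symm h1
    · exact h.count a ha
  · rw [h6]
    refine hlast (fun i' hi' => ?_) (by simp)
    rw [Function.update_apply]
    split_ifs with h1
    · rw [firstOcc_eq_iff.2 ((key_eq_iff hf).1 h1)]
    · exact h.name i' hi'
  · rw [hrr, h.realReg]
  · rw [hra, h.realArr]

theorem extendBody_wp {ρ : State} {k i : ℕ}
    (hW : (y.length + x.length + 1) * (y.length + x.length + 1) * (D + 1) ≤ W)
    (hi : i + k < y.length + x.length) {σ : State} (h : ExtendInv y x p ρ k i σ) :
    extendBody.WP W 18 (ExtendInv y x p ρ k (i + 1)) σ := by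
  have hI := h
  obtain ⟨⟨r0, r1, r2, r3, r4, r5, r6, a0, rr5, ra0⟩, r7, r13, r10, r11, flag, newName, oldName,
    newPrev, oldPrev, savedPrev, count, name, hrr, hra⟩ := h
  have hf : ∀ i, letters (y ++ x) i ≤ D := letters_le _
  set f := letters (y ++ x) with hfdef
  set N := y.length + x.length with hN
  have e2 := oldName i le_rfl hi.le
  have e3 := oldPrev i le_rfl hi.le
  have hkey : (k * (N + 1) + firstOcc f k i) * (D + 1) + f (i + k) = key f D (N + 1) k i := rfl
  have e5 := count _ (key_ge f D (N + 1) k i)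
  rw [← prevCount_eq_card_key hf] at e5
  have hfo := firstOcc_le f k i
  have hfo' := firstOcc_le f (k + 1) i
  have hlt := key_lt (k := k) (D := D) hf (show i < N + 1 by omega)
  have hb := le_bound hW (by omega) hlt
  have hp := prevCount_le f k i
  have hp' := prevCount_le f (k + 1) i
  have hD := hf (i + k)
  have hsmall : k * (N + 1) + firstOcc f k i ≤ W := by
    have : (k * (N + 1) + firstOcc f k i) * 1 ≤ (k * (N + 1) + firstOcc f k i) * (D + 1) := by
      gcongr; omega
    omega
  have hbase : (k + 1) * (N + 1) + N + 1 ≤ W := by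
    have h1 : (k + 1) * (N + 1) ≤ N * (N + 1) := by gcongr; omega
    nlinarith
  have hk2 : f (i + k) ≤ W := by omega
  refine Prog.WP.mono (T := 10 + (3 + 4)) (.seq (.block ?_ le_rfl)) (by norm_num) fun _ => id
  simp only [blockWP, Instr.Pre, Instr.eff, Function.update_apply, r4, r5,
    r10, r11, a0, e2, e3, hkey, e5, Nat.reduceEqDiff, if_true, if_false]
  refine ⟨by omega, by omega, by omega, by omega, by omega, trivial, by omega, trivial, by omega,
    trivial, .seq (.branch (fun hb => .block ?_ le_rfl) fun hb => .block ?_ (by simp))⟩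
  · simp only [Test.Holds, Function.update_apply, r4, Nat.reduceEqDiff, if_true, if_false] at hb
    have h0 : prevCount f (k + 1) i = 0 := by omega
    simp only [blockWP, Instr.Pre, Instr.eff, Function.update_apply, r13,
      r10, Nat.reduceEqDiff, if_true, if_false]
    refine ⟨by omega, trivial, .block ?_ le_rfl⟩
    simp only [blockWP, Instr.Pre, Instr.eff, Function.update_apply, r4,
      r10, r11, Nat.reduceEqDiff, if_true, if_false]
    refine ⟨by omega, trivial, by omega, by omega, ?_⟩
    refine hI.step hi ?_ ?_ ?_ ?_ ?_ ?_ ?_ ?_ ?_ ?_ rfl rfl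
    · intro r hr
      simp only [Function.update_apply]
      split_ifs <;> first | rfl | omega
    all_goals simp [h0, firstOcc_eq_self h0, ← hfdef, ← hN]
    omega
  · simp only [Test.Holds, Function.update_apply, r4, Nat.reduceEqDiff, if_true, if_false] at hb
    have h0 : prevCount f (k + 1) i ≠ 0 := by omega
    -- An earlier occurrence has the same key, so the table of names already holds the right entry.
    obtain ⟨i', hi', hs⟩ : ∃ i' < i, Same f (k + 1) i' i := by
      by_contra hc
      push Not at hc
      exact h0 (prevCount_eq_zero.2 hc)
    have e6 := name i' hi'
    rw [(key_eq_iff hf).2 hs, firstOcc_eq_iff.2 hs] at e6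
    simp only [blockWP, Instr.Pre, Instr.eff]
    refine ⟨by omega, .block ?_ le_rfl⟩
    simp only [blockWP, Instr.Pre, Instr.eff, Function.update_apply, r4, e6,
      r10, r11, Nat.reduceEqDiff, if_true, if_false]
    refine ⟨by omega, trivial, by omega, by omega, ?_⟩
    refine hI.step hi ?_ ?_ ?_ ?_ ?_ ?_ ?_ ?_ ?_ ?_ rfl rfl
    · intro r hr
      simp only [Function.update_apply]
      split_ifs <;> first | rfl | omega
    all_goals simp [h0, ← hfdef, ← hN]
    · omega
    -- Array 6 is not written in this branch; the update required by `ExtendInv.step` leaves it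
    -- unchanged.
    · exact e6


theorem Fixed.congr {σ τ : State} (h : Fixed y x p σ) (hreg : ∀ r < 7, τ.reg r = σ.reg r)
    (h0 : τ.arr 0 = σ.arr 0) (h5 : τ.realReg 5 = σ.realReg 5)
    (hra : τ.realArr 0 = σ.realArr 0) : Fixed y x p τ :=
  ⟨by rw [hreg _ (by simp), h.r0], by rw [hreg _ (by simp), h.r1],
    by rw [hreg _ (by simp), h.r2], by rw [hreg _ (by simp), h.r3],
    by rw [hreg _ (by simp), h.r4], by rw [hreg _ (by simp), h.r5],
    by rw [hreg _ (by simp), h.r6], by rw [h0, h.a0], by rw [h5, h.rr5],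
    by rw [hra]; exact h.ra0⟩

/-- The memory contents after the orders below `k` have been treated. -/
structure LevelInv (y x : List (Fin D)) (p : ℕ → ℝ) (k : ℕ) (σ : State) : Prop
    extends Fixed y x p σ where
  r7 : σ.reg 7 = k
  r8 : σ.reg 8 = k * (y.length + x.length + 1)
  flag : (σ.reg 9 = 0 ∧ ∀ i, i + k ≤ y.length + x.length →
      prevCount (letters (y ++ x)) k i = 0) ∨
    (σ.reg 9 = 1 ∧ ∃ i, i + k ≤ y.length + x.length ∧ prevCount (letters (y ++ x)) k i ≠ 0)
  name : ∀ i, i + k ≤ y.length + x.length → σ.arr 2 i =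
    k * (y.length + x.length + 1) + firstOcc (letters (y ++ x)) k i
  prev : ∀ i, i + k ≤ y.length + x.length → σ.arr 3 i = prevCount (letters (y ++ x)) k i
  count : ∀ a, k * (y.length + x.length + 1) * (D + 1) ≤ a → σ.arr 5 a = 0
  total : σ.realReg 0 = ∑ m ∈ Finset.range (k + 1), weight y p x x.length m
  cond : ∀ l, k ≤ l → l < x.length → σ.realArr 1 l = condProbAux y x l k
  part : ∀ l, k ≤ l → l < x.length → σ.realArr 2 l = weight y p x l k

theorem extend_wp {k : ℕ}
    (hW : (y.length + x.length + 1) * (y.length + x.length + 1) * (D + 1) ≤ W)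
    (hk : k < y.length + x.length) {σ : State} (h : LevelInv y x p k σ) :
    (Prog.seq extendStart (.loop (.lt 11 3) extendBody)).WP W
      (19 * (y.length + x.length) + 5) (ExtendInv y x p σ k (y.length + x.length - k)) σ := by
  have hb : (k + 1) * (y.length + x.length + 1) ≤ W := by
    have h1 : (k + 1) * (y.length + x.length + 1) ≤
        (y.length + x.length) * (y.length + x.length + 1) := Nat.mul_le_mul_right _ (by omega)
    nlinarith
  have hkW : k ≤ W := by nlinarith
  refine Prog.WP.seq' (T := 4) (U := (y.length + x.length - k) * (18 + 1) + 1)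
    (R := ExtendInv y x p σ k 0) (.block ?_ le_rfl) (fun τ hτ => .loop _ ?_ ?_ hτ) (by omega)
  · simp only [blockWP, Instr.Pre, Instr.eff, Function.update_apply, h.r6, h.r7, h.r8,
      Nat.reduceEqDiff, if_true, if_false]
    refine ⟨by omega, by omega, by omega, by rw [add_one_mul] at hb; exact hb, ?_⟩
    constructor
    · refine h.toFixed.congr (fun r hr => ?_) rfl rfl rfl
      simp only [Function.update_apply]
      split_ifs <;> first | rfl | omega
    all_goals simp [h.r7]
    · ring
    · exact h.name
    · exact h.prev
    · exact h.count
  · intro i hi τ hτ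
    refine ⟨?_, extendBody_wp hW (by omega) hτ⟩
    simp only [Test.Holds, hτ.r11, hτ.r3]
    omega
  · intro τ hτ
    simp only [Test.Holds, hτ.r11, hτ.r3]
    omega

theorem mixStart_wp {k : ℕ} (hW : y.length + x.length + 1 ≤ W)
    (hk : k ≤ y.length + x.length) {σ : State} (h : Fixed y x p σ) (h7 : σ.reg 7 = k) :
    mixStart.WP W 4 (fun τ => Fixed y x p τ ∧ τ.reg 10 = k ∧ τ.reg 11 = y.length ∧
      τ.realReg 1 = 0 ∧ τ.reg 7 = k ∧ τ.reg 9 = σ.reg 9 ∧ τ.reg 13 = σ.reg 13 ∧ τ.arr = σ.arr ∧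
      τ.realArr = σ.realArr ∧ τ.realReg 0 = σ.realReg 0) σ := by
  refine .block ?_ le_rfl
  simp only [blockWP, Instr.Pre, Instr.eff, State.setReal, Function.update_apply, h.r1, h7, h.rr5,
    Nat.reduceEqDiff, if_true, if_false]
  refine ⟨by omega, by omega, by omega, trivial, ?_⟩
  refine ⟨h.congr (fun r hr => ?_) rfl (by simp) rfl, by simp⟩
  simp only [Function.update_apply]
  split_ifs <;> first | rfl | omega

/-- The update of the probabilities of order `k` at the first `i` of the places `k, k + 1, …`. -/
structure MixInv (y x : List (Fin D)) (p : ℕ → ℝ) (ρ : State) (k i : ℕ) (σ : State) : Prop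
    extends Fixed y x p σ where
  r7 : σ.reg 7 = k
  r10 : σ.reg 10 = k + i
  r11 : σ.reg 11 = y.length + i
  r9 : σ.reg 9 = ρ.reg 9
  r13 : σ.reg 13 = ρ.reg 13
  arr : σ.arr = ρ.arr
  total : σ.realReg 0 = ρ.realReg 0
  current : σ.realReg 1 = weight y p x (k + i) (k + 1)
  newCond : ∀ l, k ≤ l → l < k + i → σ.realArr 1 l = condProbAux y x l (k + 1)
  oldCond : ∀ l, k + i ≤ l → l < x.length → σ.realArr 1 l = condProbAux y x l k
  newPart : ∀ l, k ≤ l → l < k + i → σ.realArr 2 l = weight y p x l (k + 1)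
  oldPart : ∀ l, k + i ≤ l → l < x.length → σ.realArr 2 l = weight y p x l k

theorem mixBody_wp {ρ : State} {k i : ℕ} (hW : y.length + x.length + 1 ≤ W)
    (hi : k + i < x.length)
    (h3 : ρ.arr 3 (y.length + i) = prevCount (letters (y ++ x)) (k + 1) (y.length + i))
    (h4 : ρ.arr 4 (y.length + i) = prevCount (letters (y ++ x)) k (y.length + i))
    {σ : State} (h : MixInv y x p ρ k i σ) :
    mixBody.WP W 19 (MixInv y x p ρ k (i + 1)) σ := by
  have e1 := h.oldCond _ le_rfl hi
  have e2 := h.oldPart _ le_rfl hi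
  have e0 := h.ra0 _ hi
  have hc : condProbAux y x (k + i) (k + 1) = _ := condProbAux_succ (by omega) hi
  rw [show k + i - k = i by omega] at hc
  have b3 := prevCount_le (letters (y ++ x)) (k + 1) (y.length + i)
  have b4 := prevCount_le (letters (y ++ x)) k (y.length + i)
  refine .block ?_ le_rfl
  simp only [blockWP, Instr.Pre, Instr.eff, State.setReal, Function.update_apply, h.r11, h.arr, h3,
    h4, h.r4, h.r10, e1, h.rr5, e0, e2, h.current, Nat.cast_add, Nat.cast_one, ← hc,
    Nat.reduceEqDiff, if_true, if_false, OfNat.zero_ne_ofNat, zero_ne_one]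
  refine ⟨by omega, by omega, by omega, trivial, trivial, trivial, trivial, by positivity, trivial,
    trivial, trivial, trivial, trivial, trivial, trivial, trivial, trivial, by omega, by omega, ?_⟩
  have hreg : ∀ l, k ≤ l → l < k + (i + 1) → l = k + i ∨ (l ≠ k + i ∧ l < k + i) := by omega
  constructor
  · refine h.toFixed.congr (fun r hr => ?_) (by simp [h.arr]) (by simp) (by simp)
    simp only [Function.update_apply]
    split_ifs <;> first | rfl | omega
  all_goals simp
  · exact h.r7
  · ring
  · ring
  · exact h.r9
  · exact h.r13
  · exact h.total
  · rw [← add_assoc, weight_succ_succ]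
  · intro l h1 h2
    rcases hreg l h1 h2 with rfl | ⟨h3, h4⟩
    · simp
    · simp [h3, h.newCond l h1 h4]
  · intro l h1 h2
    rw [Function.update_of_ne (by omega), h.oldCond l (by omega) h2]
  · intro l h1 h2
    rcases hreg l h1 h2 with rfl | ⟨h3, h4⟩
    · simp
    · simp [h3, h.newPart l h1 h4]
  · intro l h1 h2
    rw [Function.update_of_ne (by omega), h.oldPart l (by omega) h2]

theorem levelBody_wp {k : ℕ}
    (hW : (y.length + x.length + 1) * (y.length + x.length + 1) * (D + 1) ≤ W)
    (hk : k < y.length + x.length) {σ : State} (h : LevelInv y x p k σ) :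
    levelBody.WP W (39 * (y.length + x.length) + 14) (LevelInv y x p (k + 1)) σ := by
  have hb : (k + 1) * (y.length + x.length + 1) ≤ W := by
    have h1 : (k + 1) * (y.length + x.length + 1) ≤
        (y.length + x.length) * (y.length + x.length + 1) := Nat.mul_le_mul_right _ (by omega)
    nlinarith
  have hN : y.length + x.length + 1 ≤ W := by nlinarith
  refine Prog.WP.seq' (extend_wp hW hk h) (fun ρ hρ => ?_)
    (show _ + (20 * (y.length + x.length) + 9) ≤ _ by omega)
  refine Prog.WP.seq' (T := 4 + ((x.length - k) * (19 + 1) + 1)) (U := 4)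
    (R := MixInv y x p ρ k (x.length - k))
    (Prog.WP.seq' (mixStart_wp hN hk.le hρ.toFixed hρ.r7)
      (fun τ hτ => .loop (MixInv y x p ρ k) ?_ ?_ ?_) le_rfl)
    (fun τ hτ => .block ?_ le_rfl) (by omega)
  · intro i hi υ hυ
    refine ⟨?_, mixBody_wp hN (by omega) (hρ.newPrev _ (by omega)) (hρ.savedPrev _ (by omega)) hυ⟩
    simp only [Test.Holds, hυ.r10, hυ.r2]
    omega
  · intro υ hυ
    simp only [Test.Holds, hυ.r10, hυ.r2]
    omega
  · obtain ⟨h1, h10, h11, hr1, h7, h9, h13, harr, hra, hr0⟩ := hτ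
    refine ⟨h1, h7, h10, h11, h9, h13, harr, hr0, ?_, by omega, ?_, by omega, ?_⟩
    · rw [hr1, weight_eq_zero (by omega)]
    · rw [hra, hρ.realArr]; exact h.cond
    · rw [hra, hρ.realArr]; exact h.part
  · simp only [blockWP, Instr.Pre, Instr.eff, State.setReal, Function.update_apply, hτ.r4, hτ.r7,
      hτ.r13, hρ.r13, Nat.reduceEqDiff, if_true, if_false]
    refine ⟨trivial, by omega, by omega, by omega, ?_⟩
    constructor
    · refine hτ.toFixed.congr (fun r hr => ?_) rfl (by simp) rfl
      simp only [Function.update_apply]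
      split_ifs <;> first | rfl | omega
    all_goals simp [hτ.arr]
    · rw [hτ.r9]
      rcases hρ.flag with ⟨h9, h⟩ | ⟨h9, i, hi, h⟩
      · exact .inl ⟨h9, fun i hi => h i (by omega)⟩
      · exact .inr ⟨h9, i, by omega, h⟩
    · exact fun i hi => hρ.newName i (by omega)
    · exact fun i hi => hρ.newPrev i (by omega)
    · intro a ha
      -- The keys used so far lie below the range of the next length, where all counters are
      -- therefore still 0.
      have h0 : k * (y.length + x.length + 1) * (D + 1) ≤
        (k + 1) * (y.length + x.length + 1) * (D + 1) := by gcongr; omega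
      rw [hρ.count a (h0.trans ha), Finset.card_eq_zero, Finset.filter_eq_empty_iff]
      intro i hi he
      rw [Finset.mem_range] at hi
      have := key_lt (k := k) (a := i) (letters_le (y ++ x))
        (show i < y.length + x.length + 1 by omega)
      omega
    · rw [Finset.sum_range_succ, hτ.total, hρ.realReg, h.total, hτ.current]
      congr 1
      -- For k > |x| the sweep is empty and both weights vanish.
      rcases le_total k x.length with h1 | h1
      · rw [Nat.add_sub_cancel' h1]
      · rw [weight_eq_zero (by omega), weight_eq_zero (by omega)]
    · exact fun l h1 h2 => hτ.newCond l (by omega) (by omega)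
    · exact fun l h1 h2 => hτ.newPart l (by omega) (by omega)

/-- The summation of the weights of the orders from `k` on, at the first `i` of the places
`k, k + 1, …`. -/
structure TailInv (y x : List (Fin D)) (p : ℕ → ℝ) (ρ : State) (k i : ℕ) (σ : State) : Prop
    extends Fixed y x p σ where
  r10 : σ.reg 10 = k + i
  realArr : σ.realArr = ρ.realArr
  total : σ.realReg 0 = ρ.realReg 0
  current : σ.realReg 1 = tailWeight y p x k (k + i)

theorem tailBody_wp {ρ : State} {k i : ℕ} (hW : y.length + x.length + 1 ≤ W) (hk : 0 < k)
    (hu : ∀ i, i + k ≤ (y ++ x).length → prevCount (letters (y ++ x)) k i = 0)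
    (hi : k + i < x.length) (hρ : LevelInv y x p k ρ) {σ : State} (h : TailInv y x p ρ k i σ) :
    tailBody.WP W 8 (TailInv y x p ρ k (i + 1)) σ := by
  have e1 := hρ.cond _ (Nat.le_add_right k i) hi
  have e2 := hρ.part _ (Nat.le_add_right k i) hi
  have e0 := hρ.ra0 _ hi
  refine .block ?_ le_rfl
  simp only [blockWP, Instr.Pre, Instr.eff, State.setReal, Function.update_apply, h.realArr,
    h.r4, h.r10, e1, h.rr5, e0, e2, h.current,
    Nat.reduceEqDiff, if_true, if_false]
  refine ⟨trivial, trivial, trivial, trivial, trivial, trivial, trivial, by omega, ?_⟩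
  constructor
  · refine h.toFixed.congr (fun r hr => ?_) rfl (by simp) (by simp [h.realArr])
    simp only [Function.update_apply]
    split_ifs <;> first | rfl | omega
  all_goals simp
  · ring
  · exact h.total
  · rw [← add_assoc, tailWeight_succ hk hu hi]

/-- The initialization, after `i` letters of `x`. -/
structure InitInv (y x : List (Fin D)) (p : ℕ → ℝ) (i : ℕ) (σ : State) : Prop where
  r0 : σ.reg 0 = D
  r1 : σ.reg 1 = y.length
  r2 : σ.reg 2 = x.length
  r3 : σ.reg 3 = y.length + x.length
  r4 : σ.reg 4 = 1
  r5 : σ.reg 5 = D + 1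
  r6 : σ.reg 6 = y.length + x.length + 1
  r7 : σ.reg 7 = 0
  r8 : σ.reg 8 = 0
  r10 : σ.reg 10 = i
  a0 : ∀ a, σ.arr 0 a = if y.length ≤ a ∧ a < y.length + i then letters x (a - y.length)
    else letters y a
  a1 : σ.arr 1 = letters x
  a2 : ∀ a, σ.arr 2 a = 0
  a5 : ∀ a, σ.arr 5 a = 0
  rr0 : σ.realReg 0 = 0
  rr5 : σ.realReg 5 = 1
  rr7 : σ.realReg 7 = 1 / D
  rr1 : σ.realReg 1 = weight y p x i 0
  ra0 : ∀ l < x.length, σ.realArr 0 l = p l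
  ra1 : ∀ l < i, σ.realArr 1 l = 1 / D
  ra2 : ∀ l < i, σ.realArr 2 l = weight y p x l 0

theorem initConsts_wp (hW : y.length + x.length + 1 ≤ W) (hD : D ≠ 0) (hDW : D + 1 ≤ W) :
    initConsts.WP W 8 (InitInv y x p 0) (inputState y x p) := by
  refine .block ?_ le_rfl
  simp only [blockWP, Instr.Pre, Instr.eff, State.setReal, Function.update_apply, inputState,
    Nat.reduceEqDiff, if_true, if_false, OfNat.ofNat_ne_zero, one_ne_zero, Nat.cast_one]
  refine ⟨by omega, by omega, by omega, by omega, trivial, trivial, by exact_mod_cast hD, trivial,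
    ?_⟩
  constructor <;> simp [weight]
  · intro a h1 h2; omega

theorem initBody_wp {i : ℕ} (hW : y.length + x.length + 1 ≤ W) (hDW : D + 1 ≤ W)
    (hi : i < x.length) {σ : State} (h : InitInv y x p i σ) :
    initBody.WP W 9 (InitInv y x p (i + 1)) σ := by
  have hl := letters_le x i
  have e0 := h.ra0 i hi
  refine .block ?_ le_rfl
  simp only [blockWP, Instr.Pre, Instr.eff, State.setReal, Function.update_apply, h.r10, h.a1,
    h.r1, h.r4, h.rr1, h.rr7, e0, Nat.reduceEqDiff, if_true, if_false,
    OfNat.zero_ne_ofNat, zero_ne_one]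
  refine ⟨by omega, by omega, trivial, trivial, trivial, trivial, trivial, trivial, by omega, ?_⟩
  have hlast : ∀ {P : ℕ → Prop}, (∀ i' < i, P i') → P i → ∀ i' < i + 1, P i' := by
    intro P h1 h2 i' hi'
    rcases Nat.lt_succ_iff_lt_or_eq.1 hi' with h | rfl
    exacts [h1 i' h, h2]
  constructor
  case a0 =>
    intro a
    simp only [Function.update_self, Function.update_apply, h.a0]
    by_cases h1 : a = y.length + i
    · simp [h1]
    · rw [if_neg h1]
      congr 1
      simp only [eq_iff_iff]
      omega
  case ra1 =>
    refine hlast (fun l hl => ?_) (by simp)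
    simp [hl.ne, h.ra1 l hl]
  case ra2 =>
    refine hlast (fun l hl => ?_) (by simp)
    simp [hl.ne, h.ra2 l hl]
  all_goals simp
  exacts [h.r0, h.r1, h.r2, h.r3, h.r4, h.r5, h.r6, h.r7, h.r8, h.a1, h.a2, h.a5, h.rr0, h.rr5,
    by simpa using h.rr7, by rw [weight_succ_zero]; simp, h.ra0]

theorem levelInv_zero_wp (hW : y.length + x.length + 1 ≤ W) (hx : x ≠ [])
    {σ : State} (h : InitInv y x p x.length σ) :
    (Prog.seq initMid (.seq (.loop (.lt 10 6) countBody) initEnd)).WP W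
      (3 * (y.length + x.length) + 7) (LevelInv y x p 0) σ := by
  have hn : 0 < x.length := List.length_pos_of_ne_nil hx
  have ha0 : σ.arr 0 = letters (y ++ x) := by
    funext a
    rw [h.a0, letters_append]
    by_cases h1 : a < y.length
    · rw [if_neg (by omega), if_pos h1]
    · rw [if_neg h1]
      split_ifs with h2
      · rfl
      · rw [letters, dif_neg h1, letters, dif_neg (by omega)]
  let I : ℕ → State → Prop := fun i τ => Fixed y x p τ ∧ τ.reg 7 = 0 ∧ τ.reg 8 = 0 ∧
    τ.reg 10 = i ∧ (∀ a, τ.arr 2 a = 0) ∧ (∀ a < i, τ.arr 3 a = a) ∧ (∀ a, τ.arr 5 a = 0) ∧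
    τ.realReg 0 = weight y p x x.length 0 ∧ τ.realArr = σ.realArr
  refine Prog.WP.seq' (T := 2) (R := I 0) (.block ?_ le_rfl) (fun τ hτ => Prog.WP.seq'
    (Prog.WP.loop (T := 2) (m := y.length + x.length + 1) I ?_ ?_ hτ) (fun υ hυ => ?_) le_rfl)
    (show 2 + (((y.length + x.length + 1) * (2 + 1) + 1) + 1) ≤ _ by omega)
  · simp only [blockWP, Instr.Pre, Instr.eff, State.setReal, h.rr0, h.rr1]
    refine ⟨trivial, by omega, ?_⟩
    refine ⟨⟨h.r0, h.r1, h.r2, h.r3, h.r4, h.r5, h.r6, ha0, h.rr5, h.ra0⟩, h.r7, h.r8, rfl, h.a2,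
      by simp, h.a5, by simp, rfl⟩
  · rintro i hi υ ⟨hυ, h7, h8, h10, h2, h3, h5, h0, hra⟩
    refine ⟨by simp only [Test.Holds, h10, hυ.r6]; exact hi, .block ?_ le_rfl⟩
    simp only [blockWP, Instr.Pre, Instr.eff, h10, hυ.r4]
    refine ⟨trivial, by omega, ?_⟩
    refine ⟨hυ.congr (fun r hr => ?_) (by simp) rfl rfl, by simp [h7], by simp [h8], by simp,
      by simp [h2], ?_, by simp [h5], h0, hra⟩
    · simp only [Function.update_apply]
      split_ifs <;> first | rfl | omega
    · intro a ha
      simp only [Function.update_self, Function.update_apply]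
      split_ifs with h1
      · exact h1.symm
      · exact h3 a (by omega)
  · rintro υ ⟨hυ, h7, h8, h10, h2, h3, h5, h0, hra⟩
    simp only [Test.Holds, h10, hυ.r6]
    omega
  · obtain ⟨hυ, h7, h8, h10, h2, h3, h5, h0, hra⟩ := hυ
    refine .block ?_ le_rfl
    simp only [blockWP, Instr.Pre, Instr.eff]
    refine ⟨by omega, ?_⟩
    constructor
    · refine hυ.congr (fun r hr => ?_) rfl rfl rfl
      simp only [Function.update_apply]
      split_ifs <;> first | rfl | omega
    all_goals simp only [Function.update_apply, Nat.reduceEqDiff, if_false, if_true, hra]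
    · exact h7
    · simpa using h8
    -- The empty word at place 1 has a previous occurrence at place 0, so the first round always
    -- takes place.
    · exact .inr ⟨trivial, 1, by omega, by simp [prevCount_zero]⟩
    · exact fun i _ => by simp [h2, firstOcc_zero]
    · exact fun i hi => by rw [h3 i (by omega), prevCount_zero]
    · exact fun a _ => h5 a
    · simpa using h0
    · exact fun l _ hl => by rw [h.ra1 l hl, condProbAux]
    · exact fun l _ hl => h.ra2 l hl

theorem exists_unrepeated (y x : List (Fin D)) (hx : x ≠ []) :
    ∃ k, 0 < k ∧ k ≤ y.length + x.length ∧ k ≤ depth (y ++ x) + 1 ∧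
      (∀ i, i + k ≤ y.length + x.length → prevCount (letters (y ++ x)) k i = 0) ∧
      ∀ k' < k, ∃ i, i + k' ≤ y.length + x.length ∧ prevCount (letters (y ++ x)) k' i ≠ 0 := by
  have hn : 0 < x.length := List.length_pos_of_ne_nil hx
  let P : ℕ → Prop := fun k =>
    ∀ i, i + k ≤ y.length + x.length → prevCount (letters (y ++ x)) k i = 0
  -- A word of length N fits only at place 0.
  have hN : P (y.length + x.length) := fun i hi => by
    have := prevCount_le (letters (y ++ x)) (y.length + x.length) i
    omega
  classical
  have hex : ∃ k, P k := ⟨_, hN⟩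
  have hlt : ∀ k' < Nat.find hex,
      ∃ i, i + k' ≤ y.length + x.length ∧ prevCount (letters (y ++ x)) k' i ≠ 0 := by
    intro k' hk'
    have := Nat.find_min hex hk'
    simp only [P] at this
    push Not at this
    exact this
  have hpos : 0 < Nat.find hex := by
    refine (Nat.find_pos hex).2 fun h => ?_
    simpa [prevCount_zero] using h 1 (by omega)
  refine ⟨Nat.find hex, hpos, Nat.find_min' hex hN, ?_, Nat.find_spec hex, hlt⟩
  -- By minimality a word of length k - 1 is repeated, hence k - 1 ≤ L(z).
  obtain ⟨i, hi, h⟩ := hlt (Nat.find hex - 1) (by omega)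
  have := le_depth (by simpa using hi) h
  omega

theorem switchProg_wp
    (hW : (y.length + x.length + 1) * (y.length + x.length + 1) * (D + 1) ≤ W) (hx : x ≠ []) :
    switchProg.WP W (200 * ((y.length + x.length) * max 1 (depth (y ++ x))))
      (fun τ => τ.realReg 0 = switchProb y p x) (inputState y x p) := by
  have hn : 0 < x.length := List.length_pos_of_ne_nil hx
  have hD : D ≠ 0 := by
    rintro rfl
    exact (x.head hx).elim0
  have hN : y.length + x.length + 1 ≤ W := by nlinarith
  have hDW : D + 1 ≤ W :=
    (Nat.le_mul_of_pos_left (D + 1) (Nat.mul_pos (Nat.succ_pos _) (Nat.succ_pos _))).trans hW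
  obtain ⟨k, hk0, hkN, hkd, hu, hr⟩ := exists_unrepeated y x hx
  have htime : 8 + ((x.length * (9 + 1) + 1) + ((3 * (y.length + x.length) + 7) +
      ((k * (39 * (y.length + x.length) + 14 + 1) + 1) +
        (4 + (((x.length - k) * (8 + 1) + 1) + 1))))) ≤
      200 * ((y.length + x.length) * max 1 (depth (y ++ x))) := by
    set s := max 1 (depth (y ++ x))
    have h1 : 1 ≤ s := le_max_left _ _
    have h2 : depth (y ++ x) ≤ s := le_max_right _ _
    -- k ≤ L(z) + 1 ≤ 2s. The rounds thus cost at most 108 N s, and the linear remainder fits into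
    -- 200 N s.
    have h3 : k ≤ 2 * s := by omega
    have h4 : k * (39 * (y.length + x.length) + 14 + 1) ≤
        2 * s * (54 * (y.length + x.length)) := Nat.mul_le_mul h3 (by omega)
    have h6 : 2 * s * (54 * (y.length + x.length)) = 108 * ((y.length + x.length) * s) := by ring
    have h5 : (y.length + x.length) * 1 ≤ (y.length + x.length) * s := by gcongr
    generalize (y.length + x.length) * s = u at *
    generalize k * (39 * (y.length + x.length) + 14 + 1) = v at *
    omega
  refine Prog.WP.seq' (T := 8) (initConsts_wp hN hD hDW) (fun τ hτ => ?_) htime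
  refine Prog.WP.seq' (.loop (InitInv y x p) (fun i hi τ hτ => ?_) (fun τ hτ => ?_) hτ)
    (fun τ hτ => ?_) le_rfl
  · refine ⟨?_, initBody_wp hN hDW hi hτ⟩
    simp only [Test.Holds, hτ.r10, hτ.r2]
    exact hi
  · simp only [Test.Holds, hτ.r10, hτ.r2]
    omega
  refine Prog.WP.seq' (levelInv_zero_wp hN hx hτ) (fun τ hτ => ?_) le_rfl
  refine Prog.WP.seq' (.loop (LevelInv y x p) (m := k) (fun i hi τ hτ => ?_) (fun τ hτ => ?_) hτ)
    (fun ρ hρ => ?_) le_rfl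
  · refine ⟨?_, levelBody_wp hW (by omega) hτ⟩
    obtain ⟨i', hi', h⟩ := hr i hi
    rcases hτ.flag with ⟨-, h9⟩ | ⟨h9, -⟩
    · exact absurd (h9 i' hi') h
    · simp only [Test.Holds, hτ.r4, h9]
  · rcases hτ.flag with ⟨h9, -⟩ | ⟨-, i', hi', h⟩
    · simp only [Test.Holds, hτ.r4, h9]
      omega
    · exact absurd (hu i' hi') h
  refine Prog.WP.seq' (T := 4 + ((x.length - k) * (8 + 1) + 1)) (U := 1)
    (R := TailInv y x p ρ k (x.length - k))
    (Prog.WP.seq' (mixStart_wp hN hkN hρ.toFixed hρ.r7)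
      (fun τ hτ => .loop (TailInv y x p ρ k) ?_ ?_ ?_) le_rfl)
    (fun τ hτ => .block ?_ le_rfl) (by omega)
  · intro i hi υ hυ
    refine ⟨?_, tailBody_wp hN hk0 (by simpa using hu) (by omega) hρ hυ⟩
    simp only [Test.Holds, hυ.r10, hυ.r2]
    omega
  · intro υ hυ
    simp only [Test.Holds, hυ.r10, hυ.r2]
    omega
  · obtain ⟨h1, h10, -, hr1, -, -, -, -, hra, hr0⟩ := hτ
    exact ⟨h1, h10, hra, hr0, by rw [hr1, tailWeight_eq_zero (by omega)]⟩
  · refine ⟨trivial, ?_⟩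
    simp only [blockWP, Instr.eff, State.setReal, Function.update_self]
    rw [hτ.total, hρ.total, hτ.current, switchProb_eq_tail hx k]
    congr 1
    rcases le_total k x.length with h1 | h1
    · rw [Nat.add_sub_cancel' h1]
    · rw [tailWeight_eq_zero (by omega), tailWeight_eq_zero (by omega)]

end

end SwitchDist

theorem theorem4 :
    ∃ (prog : SwitchDist.Prog) (C e : ℕ),
      ∀ (D : ℕ) (y x : List (Fin D)) (p : ℕ → ℝ), x ≠ [] → SwitchDist.IsCoeff p →
        ∃ (t : ℕ) (τ : SwitchDist.State),
          prog.Run ((y.length + x.length + D) ^ e) (SwitchDist.inputState y x p) t τ ∧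
          τ.realReg 0 = SwitchDist.switchProb y p x ∧
          t ≤ C * ((y.length + x.length) * max 1 (SwitchDist.depth (y ++ x))) := by
  refine ⟨SwitchDist.switchProg, 200, 3, fun D y x p hx _ => ?_⟩
  have hn : 0 < x.length := List.length_pos_of_ne_nil hx
  have hD : 0 < D := (x.head hx).pos
  obtain ⟨t, τ, ht, hr, hq⟩ := SwitchDist.switchProg_wp (y := y) (p := p)
    -- The exponent 3 suffices because N ≥ 1 and D ≥ 1: the factors N + 1, N + 1 and D + 1 of the
    -- bound on the keys are each at most N + D.
    (W := (y.length + x.length + D) ^ 3) (by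
      rw [pow_succ, pow_two]
      exact Nat.mul_le_mul (Nat.mul_le_mul (by omega) (by omega)) (by omega)) hx
  exact ⟨t, τ, hr, hq, ht⟩
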